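/- Let $n\ge 1$ and let $x=(x_1,\dots,x_n)$ be independent random variables, each uniformly distributed on $\{1,\dots,n\}$. The algorithm LINEAR tests whether a sequence $s=(s_1,\dots,s_n)$ with entries in $\{1,\dots,n\}$ has pairwise different entries, as follows: it sets $g\leftarrow\text{True}$ and $v_i\leftarrow 0$ for $i=1,\dots,n$; then, for $i=1,\dots,n$ in this order, it tests whether $v_{s_i}>0$; if so, it sets $g\leftarrow\text{False}$ and returns $g$, otherwise it sets $v_{s_i}\leftarrow v_{s_i}+1$; if the loop ends without a return, it returns $g$. Its running time on $s$ is the number of executed assignments $\leftarrow$ displayed here plus the number of executed comparisons $v_{s_i}>0$ (the administration of the loop counters is not counted). For $n\ge 1$ put $$\kappa(n)=\frac13-\sqrt{\frac{\pi n}{2}}+\sum_{k=1}^{n}\frac{n!\,k^2}{(n-k)!\,n^{k+1}}.$$ Then for every $n\ge 1$ the expected running time $T_L$ of LINEAR on the input $x$ is $$T_L=n+\sqrt{2\pi n}+\frac73+2\kappa(n)-2\,\frac{n!}{n^n},$$ and $\kappa$ is strictly decreasing, $\kappa(n+1)<\kappa(n)$ for all $n\ge1$, with $\kappa(n)\to0$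 as $n\to\infty$. -/

import Mathlib

open MeasureTheory ProbabilityTheory
open scoped ENNReal Nat Topology

/-- The result of a computation together with the numbers of assignments and of comparisons
that were executed to obtain it. -/
structure Counted (α : Type) where
  /-- the value computed -/
  val : α
  /-- number of executed assignments -/
  assignments : ℕ
  /-- number of executed comparisons -/
  comparisons : ℕ

/-- Sequential composition adds up the costs; returning a value is free. -/
instance : Monad Counted where
  pure a := ⟨a, 0, 0⟩
  bind c f :=
    ⟨(f c.val).val, c.assignments + (f c.val).assignments,
      c.comparisons + (f c.val).comparisons⟩

namespace Counted

/-- One executed assignment: the new content of the variable that is written.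
(For one entry of a vector: the vector with that entry overwritten.) -/
def assign {α : Type} (a : α) : Counted α := ⟨a, 1, 0⟩

/-- One executed comparison: the test `0 < a`. -/
def testPos (a : ℕ) : Counted Bool := ⟨decide (0 < a), 0, 1⟩

/-- The running time: assignments plus comparisons. -/
def time {α : Type} (c : Counted α) : ℕ := c.assignments + c.comparisons

end Counted

open Counted in
/-- The algorithm LINEAR, run on the sequence `s` of length `n`. The type `Fin n` is used both for
the positions `1, …, n` and for the values `1, …, n`; `v₀` is the (arbitrary) content of the work
vector before the run. As usual for the counting of assignments and comparisons in pseudocode, the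
bookkeeping of the two `for` loops is not counted. -/
def linear (n : ℕ) (v₀ : Fin n → ℕ) (s : Fin n → Fin n) : Counted Bool := do
  let mut v := v₀
  let mut g ← assign true
  for i in List.finRange n do
    v ← assign (Function.update v i 0)
  for i in List.finRange n do
    if ← testPos (v (s i)) then
      g ← assign false
      return g
    else
      v ← assign (Function.update v (s i) (v (s i) + 1))
  return g

/-- `κ(n) = 1/3 - √(πn/2) + ∑_{k=1}^n n! k² / ((n-k)! n^(k+1))`, for `n ≥ 1`. -/
noncomputable def kappa (n : ℕ) : ℝ :=
  1 / 3 - √(Real.pi * n / 2)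
    + ∑ k ∈ Finset.Icc 1 n, ((n ! : ℝ) * (k : ℝ) ^ 2) / (((n - k)! : ℝ) * (n : ℝ) ^ (k + 1))

/-!
LINEAR takes `n + 1` steps for the initialisation and two steps for every `k < n` such that the
first `k` entries are pairwise different. If `p_k = n (n - 1) ⋯ (n - k + 1) / n ^ k` is the
probability of that event, the expected running time is `n + 1 + 2 ∑_{k<n} p_k`. On the other
hand `p_k - p_{k+1} = (k / n) p_k`, so summation by parts turns the sum in `κ(n)` into
`∑_{1≤k≤n} p_k`.

For the behaviour of `κ` write `w(y) = (1 + y) e^{-y} = exp (-z² / 2)` with `z > 0`, and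
`h(y) = 1 / 3 + 1 / y - 1 / z`. Since `d(-w ^ n) = n y w ^ n / (1 + y) dy`, the three summands of
`h` integrate against `d(-w ^ n)` over `(0, ∞)` to `1 / 3`, to `∑_{1≤k≤n} p_k` (by the binomial
formula) and to the Gaussian integral `√(π n / 2)`. Hence `κ(n) = ∫ h d(-w ^ n) = ∫ w ^ n dh`,
because `h` vanishes at `0`. As `h` is increasing and `0 < w < 1`, this decreases strictly to `0`.
-/

section RealAnalysis

open Set Filter

theorem pos_of_hasDerivAt_pos {f f' : ℝ → ℝ} {a : ℝ} (ha : f a = 0)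
    (hf : ∀ x, a ≤ x → HasDerivAt f (f' x) x) (hf' : ∀ x, a < x → 0 < f' x) {x : ℝ} (hx : a < x) :
    0 < f x := by
  have hmono : StrictMonoOn f (Ici a) := by
    refine strictMonoOn_of_hasDerivWithinAt_pos (convex_Ici a)
      (fun y hy => (hf y hy).continuousAt.continuousWithinAt)
      (fun y hy => (hf y (interior_subset hy)).hasDerivWithinAt) fun y hy => hf' y ?_
    rwa [interior_Ici] at hy
  exact ha ▸ hmono self_mem_Ici hx.le hx

theorem setIntegral_lt_setIntegral_of_forall_lt {α : Type*} [MeasurableSpace α] {μ : Measure α}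
    {s : Set α} {f g : α → ℝ} (hs : MeasurableSet s) (hμs : μ s ≠ 0) (hf : IntegrableOn f s μ)
    (hg : IntegrableOn g s μ) (hfg : ∀ x ∈ s, f x < g x) :
    ∫ x in s, f x ∂μ < ∫ x in s, g x ∂μ := by
  have hpos : ∀ x ∈ s, 0 < (g - f) x := fun x hx => sub_pos.2 (hfg x hx)
  rw [← sub_pos, ← integral_sub' hg hf, setIntegral_pos_iff_support_of_nonneg_ae
    ((ae_restrict_mem hs).mono fun x hx => (hpos x hx).le) (hg.sub hf),
    inter_eq_right.2 fun x hx => Function.mem_support.2 (hpos x hx).ne']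
  exact pos_iff_ne_zero.2 hμs

theorem integrableOn_Ioi_deriv_of_nonneg_of_tendsto {g g' : ℝ → ℝ} {a l l' : ℝ}
    (hg : ∀ x ∈ Ioi a, HasDerivAt g (g' x) x) (hg' : ∀ x ∈ Ioi a, 0 ≤ g' x)
    (hl : Tendsto g (𝓝[>] a) (𝓝 l)) (hl' : Tendsto g atTop (𝓝 l')) : IntegrableOn g' (Ioi a) := by
  have heq : ∀ x ∈ Ioi a, Function.update g a l x = g x := fun x hx =>
    Function.update_of_ne (ne_of_gt hx) l g
  refine integrableOn_Ioi_deriv_of_nonneg (g := Function.update g a l) ?_ (fun x hx => ?_) hg'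
    (hl'.congr' ((eventually_gt_atTop a).mono fun x hx => (heq x hx).symm))
  · rwa [continuousWithinAt_update_same, Ici_sdiff_left]
  · exact (hg x hx).congr_of_eventuallyEq (eventually_of_mem (Ioi_mem_nhds hx) heq)

end RealAnalysis

namespace Counted

variable {α β : Type}

theorem val_bind (c : Counted α) (f : α → Counted β) : (c >>= f).val = (f c.val).val := rfl

theorem time_pure (a : α) : (pure a : Counted α).time = 0 := rfl

theorem time_assign (a : α) : (assign a).time = 1 := rfl

theorem time_bind (c : Counted α) (f : α → Counted β) :
    (c >>= f).time = c.time + (f c.val).time :=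
  Nat.add_add_add_comm ..

end Counted

theorem mem_take_finRange {n k : ℕ} {i : Fin n} : i ∈ (List.finRange n).take k ↔ (i : ℕ) < k := by
  simp only [List.mem_take_iff_getElem, List.getElem_finRange, Fin.cast_mk,
    List.length_finRange, lt_inf_iff]
  grind

theorem nodup_take_map_finRange_iff {n : ℕ} {α : Type*} (s : Fin n → α) (k : ℕ) :
    (((List.finRange n).map s).take k).Nodup ↔ Set.InjOn s {i | (i : ℕ) < k} := by
  rw [← List.map_take,
    List.nodup_map_iff_inj_on ((List.nodup_finRange n).sublist (List.take_sublist k _))]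
  simp only [mem_take_finRange]
  rfl

section Algorithm

open Counted

/-- The first loop of LINEAR, `v_i ← 0` for `i` in `l`. -/
def resetLoop {α : Type} [DecidableEq α] (l : List α) (v : α → ℕ) : Counted (α → ℕ) :=
  forIn l v fun i v => do
    let v ← assign (Function.update v i 0)
    return .yield v

/-- The second loop of LINEAR, for `i` in `l`, run on the sequence `s` and started with work vector
`v` and flag `g`. The first component of the state holds the value of an early return, if any. -/
def probeLoop {ι α : Type} [DecidableEq α] (s : ι → α) (l : List ι) (v : α → ℕ) (g : Bool) :
    Counted (Option Bool × (α → ℕ) × Bool) :=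
  forIn l (none, v, g) fun i r => do
    let (_, v, g) := r
    if ← testPos (v (s i)) then
      let g ← assign false
      return .done (some g, v, g)
    else
      let v ← assign (Function.update v (s i) (v (s i) + 1))
      return .yield (none, v, g)

theorem linear_eq_loops (n : ℕ) (v₀ : Fin n → ℕ) (s : Fin n → Fin n) :
    linear n v₀ s = do
      let g ← assign true
      let v ← resetLoop (List.finRange n) v₀
      let r ← probeLoop s (List.finRange n) v g
      return r.1.getD r.2.2 := by
  refine congrArg (assign true >>= ·) (funext fun g => congrArg (_ >>= ·) (funext fun v =>
    congrArg (_ >>= ·) (funext ?_)))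
  rintro ⟨_ | _, _, _⟩ <;> rfl

variable {ι α : Type} [DecidableEq α]

theorem resetLoop_cons (a : α) (l : List α) (v : α → ℕ) :
    resetLoop (a :: l) v = assign (Function.update v a 0) >>= resetLoop l := by
  rw [resetLoop, List.forIn_cons]
  rfl

theorem time_resetLoop (l : List α) (v : α → ℕ) : (resetLoop l v).time = l.length := by
  induction l generalizing v with
  | nil => rfl
  | cons a l ih => rw [resetLoop_cons, time_bind, time_assign, ih, List.length_cons, add_comm]

theorem val_resetLoop (l : List α) (v : α → ℕ) (b : α) :
    (resetLoop l v).val b = if b ∈ l then 0 else v b := by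
  induction l generalizing v with
  | nil => simp only [List.not_mem_nil, ↓reduceIte]; rfl
  | cons a l ih =>
    rw [resetLoop_cons, val_bind, ih]
    rcases eq_or_ne b a with rfl | hba
    · simp [assign]
    · simp [assign, hba]

theorem time_probeLoop_cons_of_pos (s : ι → α) {i : ι} {v : α → ℕ} (h : 0 < v (s i))
    (l : List ι) (g : Bool) : (probeLoop s (i :: l) v g).time = 2 := by
  rw [probeLoop, List.forIn_cons]
  simp only [testPos, h, decide_true, time_bind, ↓reduceIte, val_bind]
  rfl

theorem time_probeLoop_cons_of_eq_zero (s : ι → α) {i : ι} {v : α → ℕ} (h : v (s i) = 0)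
    (l : List ι) (g : Bool) : (probeLoop s (i :: l) v g).time =
      2 + (probeLoop s l (Function.update v (s i) 1) g).time := by
  rw [probeLoop, List.forIn_cons]
  simp only [testPos, h, lt_self_iff_false, decide_false, zero_add, time_bind,
    Bool.false_eq_true, ↓reduceIte, val_bind]
  rfl

/-- Each executed pass costs one comparison and one assignment, and the pass for the `k`-th entry of
`l` is executed iff no earlier pass has found a positive entry of the work vector. -/
theorem time_probeLoop (s : ι → α) (l : List ι) (v : α → ℕ) (g : Bool) :
    (probeLoop s l v g).time = 2 * Nat.count
      (fun k => ((l.map s).take k).Nodup ∧ ∀ a ∈ (l.map s).take k, v a = 0) l.length := by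
  induction l generalizing v with
  | nil => rfl
  | cons i l ih =>
    rw [List.length_cons, Nat.count_succ']
    rcases (v (s i)).eq_zero_or_pos with h | h
    · have hupdate (t : List α) : (t.Nodup ∧ ∀ a ∈ t, Function.update v (s i) 1 a = 0) ↔
          (s i :: t).Nodup ∧ ∀ a ∈ s i :: t, v a = 0 := by
        grind
      simp only [time_probeLoop_cons_of_eq_zero s h, ih, hupdate, List.map_cons,
        List.take_succ_cons, List.take_zero]
      simp only [List.nodup_nil, List.not_mem_nil, IsEmpty.forall_iff, implies_true, and_self,
        ↓reduceIte]
      ring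
    · simp [time_probeLoop_cons_of_pos s h, h.ne']

open Classical in
theorem time_linear (n : ℕ) (v₀ : Fin n → ℕ) (s : Fin n → Fin n) :
    (linear n v₀ s).time = n + 1 + 2 * ∑ k : Fin n, if Set.InjOn s (Set.Iio k) then 1 else 0 := by
  have hreset : (resetLoop (List.finRange n) v₀).val = fun _ => 0 := by
    ext; simp [val_resetLoop]
  have hcount : Nat.count (fun k => Set.InjOn s {i | (i : ℕ) < k}) n =
      ∑ k : Fin n, if Set.InjOn s (Set.Iio k) then 1 else 0 := by
    rw [Nat.count_eq_card_filter_range, Finset.card_filter, Finset.sum_range]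
    rfl
  simp only [linear_eq_loops, time_bind, time_assign, time_resetLoop, hreset, time_probeLoop,
    time_pure, List.length_finRange, nodup_take_map_finRange_iff, implies_true, and_true]
  rw [← hcount]
  ring

end Algorithm

theorem setOf_injOn_eq_preimage {ι α Ω : Type*} (x : ι → Ω → α) (A : Finset ι) :
    {ω | Set.InjOn (fun i => x i ω) A} = (fun ω (i : A) => x i ω) ⁻¹' {s | s.Injective} := by
  ext ω
  exact Set.injOn_iff_injective

theorem measurableSet_setOf_injOn {ι α Ω : Type*} [Countable α] [MeasurableSpace α]
    [MeasurableSingletonClass α] [MeasurableSpace Ω] {x : ι → Ω → α} (hx : ∀ i, Measurable (x i))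
    (A : Finset ι) : MeasurableSet {ω | Set.InjOn (fun i => x i ω) A} := by
  rw [setOf_injOn_eq_preimage]
  exact (show Measurable fun ω (i : A) => x i ω by fun_prop) .of_discrete

section Uniform

variable {ι α Ω : Type*} [Fintype α] [MeasurableSpace α] [MeasurableSingletonClass α]
  [MeasurableSpace Ω] {P : Measure Ω} {x : ι → Ω → α}

theorem map_pi_eq_uniformOn_univ [Finite ι] (hx : ∀ i, Measurable (x i)) (hindep : iIndepFun x P)
    (hunif : ∀ i a, P {ω | x i ω = a} = 1 / (Fintype.card α : ℝ≥0∞)) :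
    P.map (fun ω i => x i ω) = uniformOn Set.univ := by
  classical
  have := Fintype.ofFinite ι
  refine Measure.ext_of_singleton fun s => ?_
  have hpreimage : (fun ω i => x i ω) ⁻¹' {s} = ⋂ i, x i ⁻¹' {s i} := by
    ext ω
    simp [funext_iff]
  rw [Measure.map_apply (measurable_pi_lambda _ hx) (measurableSet_singleton s), hpreimage,
    hindep.meas_iInter fun i => ⟨{s i}, measurableSet_singleton _, rfl⟩, uniformOn_univ,
    Measure.count_singleton]
  calc ∏ i, P (x i ⁻¹' {s i}) = ∏ i : ι, 1 / (Fintype.card α : ℝ≥0∞) :=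
        Finset.prod_congr rfl fun i _ => hunif i (s i)
    _ = 1 / (Fintype.card (ι → α) : ℝ≥0∞) := by simp [ENNReal.inv_pow]

theorem measureReal_setOf_injOn (hx : ∀ i, Measurable (x i)) (hindep : iIndepFun x P)
    (hunif : ∀ i a, P {ω | x i ω = a} = 1 / (Fintype.card α : ℝ≥0∞)) (A : Finset ι) :
    P.real {ω | Set.InjOn (fun i => x i ω) A} =
      ((Fintype.card α).descFactorial A.card : ℝ) / (Fintype.card α : ℝ) ^ A.card := by
  classical
  have hlaw := map_pi_eq_uniformOn_univ (fun i : A => hx i)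
    (hindep.precomp Subtype.val_injective) (fun i => hunif i)
  have hcard : Measure.count {s : A → α | s.Injective} =
      (Fintype.card α).descFactorial A.card := by
    rw [Measure.count_apply_finite _ (Set.toFinite _), Set.Finite.card_toFinset,
      ← Fintype.card_coe, ← Fintype.card_embedding_eq]
    exact congrArg Nat.cast (Fintype.card_congr (Equiv.subtypeInjectiveEquivEmbedding A α))
  rw [setOf_injOn_eq_preimage, ← map_measureReal_apply (by fun_prop) .of_discrete, hlaw,
    measureReal_def, uniformOn_univ, hcard]
  simp

end Uniform

/-- The probability that `k` independent uniform samples from `n` values are pairwise different. -/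
noncomputable def distinctProb (n k : ℕ) : ℝ := (n.descFactorial k : ℝ) / (n : ℝ) ^ k

theorem integral_time_linear {n : ℕ} (v₀ : Fin n → ℕ) {Ω : Type*} [MeasurableSpace Ω]
    {P : Measure Ω} [IsProbabilityMeasure P] {x : Fin n → Ω → Fin n} (hx : ∀ i, Measurable (x i))
    (hindep : iIndepFun x P) (hunif : ∀ i k, P {ω | x i ω = k} = 1 / (n : ℝ≥0∞)) :
    ∫ ω, ((linear n v₀ fun i => x i ω).time : ℝ) ∂P =
      n + 1 + 2 * ∑ k ∈ Finset.range n, distinctProb n k := by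
  classical
  let E (k : Fin n) : Set Ω := {ω | Set.InjOn (fun i => x i ω) (Finset.Iio k)}
  have hE (k : Fin n) : MeasurableSet (E k) := measurableSet_setOf_injOn hx (Finset.Iio k)
  have hPE (k : Fin n) : P.real (E k) = distinctProb n k := by
    simpa [distinctProb, E] using
      measureReal_setOf_injOn hx hindep (by simpa using hunif) (Finset.Iio k)
  have htime (ω : Ω) : ((linear n v₀ fun i => x i ω).time : ℝ) =
      n + 1 + 2 * ∑ k, (E k).indicator 1 ω := by
    simp [time_linear, E, Set.indicator_apply]
  have hint (k : Fin n) : Integrable ((E k).indicator (1 : Ω → ℝ)) P :=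
    (integrable_const 1).indicator (hE k)
  simp only [htime]
  rw [integral_add (by fun_prop) (by fun_prop), integral_const_mul,
    integral_finsetSum _ fun k _ => hint k]
  simp [integral_indicator_one, hE, hPE, Finset.sum_range]

theorem distinctProb_zero (n : ℕ) : distinctProb n 0 = 1 := by simp [distinctProb]

theorem distinctProb_self (n : ℕ) : distinctProb n n = (n ! : ℝ) / (n : ℝ) ^ n := by
  rw [distinctProb, Nat.descFactorial_self]

theorem distinctProb_succ_self (n : ℕ) : distinctProb n (n + 1) = 0 := by
  simp [distinctProb]

theorem distinctProb_sub_succ {n : ℕ} (hn : n ≠ 0) (k : ℕ) :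
    distinctProb n k - distinctProb n (k + 1) = k / n * distinctProb n k := by
  rcases le_or_gt k n with hk | hk
  · rw [distinctProb, distinctProb, Nat.descFactorial_succ]
    push_cast [hk]
    field_simp
    ring
  · simp [distinctProb, Nat.descFactorial_of_lt hk]

theorem sum_range_mul_sub_succ {R : Type*} [CommRing R] (p : ℕ → R) (m : ℕ) :
    ∑ k ∈ Finset.range m, ((k + 1 : ℕ) : R) * (p (k + 1) - p (k + 2)) =
      ∑ k ∈ Finset.range m, p (k + 1) - m * p (m + 1) := by
  induction m with
  | zero => simp
  | succ m ih =>
    rw [Finset.sum_range_succ, Finset.sum_range_succ, ih]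
    push_cast
    ring

theorem kappa_summand_eq {n k : ℕ} (hn : n ≠ 0) (hk : k ≤ n) :
    ((n ! : ℝ) * (k : ℝ) ^ 2) / (((n - k)! : ℝ) * (n : ℝ) ^ (k + 1)) =
      k * (distinctProb n k - distinctProb n (k + 1)) := by
  rw [distinctProb_sub_succ hn, distinctProb, ← Nat.factorial_mul_descFactorial hk]
  push_cast
  field_simp
  ring

theorem kappa_eq_sum_distinctProb {n : ℕ} (hn : n ≠ 0) :
    kappa n = 1 / 3 - √(Real.pi * n / 2) + ∑ k ∈ Finset.range n, distinctProb n (k + 1) := by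
  have hsum := sum_range_mul_sub_succ (distinctProb n) n
  rw [distinctProb_succ_self, mul_zero, sub_zero] at hsum
  rw [kappa, ← hsum, Finset.sum_congr rfl fun k hk => kappa_summand_eq hn (Finset.mem_Icc.1 hk).2,
    ← Finset.Ico_add_one_right_eq_Icc, Finset.sum_Ico_eq_sum_range]
  simp only [Nat.add_sub_cancel, add_comm 1, add_assoc, Nat.reduceAdd]

section ExpWeight

open Set Filter

/-- The function `(1 + y) * exp (-y)`, whose `n`-th power is the weight in the integral
representation of `kappa n`. -/
noncomputable def expWeight (y : ℝ) : ℝ := (1 + y) * Real.exp (-y)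

theorem expWeight_zero : expWeight 0 = 1 := by simp [expWeight]

theorem expWeight_pos {y : ℝ} (hy : 0 ≤ y) : 0 < expWeight y := by unfold expWeight; positivity

theorem expWeight_lt_one {y : ℝ} (hy : 0 < y) : expWeight y < 1 := by
  rw [expWeight, Real.exp_neg, ← div_eq_mul_inv, div_lt_one (Real.exp_pos y), add_comm]
  exact Real.add_one_lt_exp hy.ne'

theorem expWeight_pow (n : ℕ) (y : ℝ) :
    expWeight y ^ n = (1 + y) ^ n * Real.exp (-(n * y)) := by
  rw [expWeight, mul_pow, ← Real.exp_nat_mul, mul_neg]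

theorem continuous_expWeight : Continuous expWeight := by unfold expWeight; fun_prop

theorem hasDerivAt_expWeight {y : ℝ} (hy : 0 ≤ y) :
    HasDerivAt expWeight (-(y / (1 + y) * expWeight y)) y := by
  refine (((hasDerivAt_id y).const_add 1).mul (hasDerivAt_neg y).exp).congr_deriv ?_
  rw [expWeight, id]
  field_simp
  ring

theorem hasDerivAt_neg_expWeight_pow {n : ℕ} (hn : n ≠ 0) {y : ℝ} (hy : 0 ≤ y) :
    HasDerivAt (fun y => -expWeight y ^ n) (n * (y / (1 + y) * expWeight y ^ n)) y := by
  refine ((hasDerivAt_expWeight hy).fun_pow n).fun_neg.congr_deriv ?_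
  rw [← mul_pow_sub_one hn (expWeight y)]
  ring

theorem tendsto_expWeight_atTop : Tendsto expWeight atTop (𝓝 0) := by
  have h := (Real.tendsto_pow_mul_exp_neg_atTop_nhds_zero 0).add
    (Real.tendsto_pow_mul_exp_neg_atTop_nhds_zero 1)
  rw [add_zero] at h
  refine h.congr fun y => ?_
  rw [expWeight, pow_zero, pow_one, add_mul]

theorem tendsto_neg_expWeight_pow_atTop {n : ℕ} (hn : n ≠ 0) :
    Tendsto (fun y => -expWeight y ^ n) atTop (𝓝 0) := by
  simpa [hn] using (tendsto_expWeight_atTop.pow n).neg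

theorem norm_expWeight_pow_le_one {y : ℝ} (hy : 0 < y) (n : ℕ) : ‖expWeight y ^ n‖ ≤ 1 := by
  have hpos := expWeight_pos hy.le
  rw [norm_pow, Real.norm_of_nonneg hpos.le]
  exact pow_le_one₀ hpos.le (expWeight_lt_one hy).le

theorem integrableOn_mul_expWeight_pow {f : ℝ → ℝ} (hf : IntegrableOn f (Ioi 0)) (n : ℕ) :
    IntegrableOn (fun y => f y * expWeight y ^ n) (Ioi 0) :=
  hf.mul_bdd (c := 1) (continuous_expWeight.pow n).aestronglyMeasurable <|
    (ae_restrict_mem measurableSet_Ioi).mono fun _ hy => norm_expWeight_pow_le_one hy n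

theorem strictAnti_integral_mul_expWeight_pow {f : ℝ → ℝ} (hf : IntegrableOn f (Ioi 0))
    (hpos : ∀ y, 0 < y → 0 < f y) :
    StrictAnti fun n : ℕ => ∫ y in Ioi 0, f y * expWeight y ^ n := fun m n hmn =>
  setIntegral_lt_setIntegral_of_forall_lt measurableSet_Ioi (by simp)
    (integrableOn_mul_expWeight_pow hf n) (integrableOn_mul_expWeight_pow hf m) fun y hy =>
      mul_lt_mul_of_pos_left (pow_lt_pow_right_of_lt_one₀ (expWeight_pos (le_of_lt hy))
        (expWeight_lt_one hy) hmn) (hpos y hy)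

theorem tendsto_integral_mul_expWeight_pow {f : ℝ → ℝ} (hf : IntegrableOn f (Ioi 0)) :
    Tendsto (fun n : ℕ => ∫ y in Ioi 0, f y * expWeight y ^ n) atTop (𝓝 0) := by
  suffices h : Tendsto (fun n : ℕ => ∫ y in Ioi 0, f y * expWeight y ^ n) atTop
      (𝓝 (∫ _ in Ioi (0 : ℝ), (0 : ℝ))) by
    rwa [integral_zero] at h
  refine tendsto_integral_of_dominated_convergence (fun y => ‖f y‖)
    (fun n => (integrableOn_mul_expWeight_pow hf n).aestronglyMeasurable) hf.norm
    (fun n => ?_) ?_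
  · filter_upwards [ae_restrict_mem measurableSet_Ioi] with y hy
    rw [norm_mul]
    exact mul_le_of_le_one_right (norm_nonneg _) (norm_expWeight_pow_le_one hy n)
  · filter_upwards [ae_restrict_mem measurableSet_Ioi] with y hy
    simpa using (tendsto_pow_atTop_nhds_zero_of_lt_one (expWeight_pos (le_of_lt hy)).le
      (expWeight_lt_one hy)).const_mul (f y)

theorem integrableOn_div_one_add_mul_expWeight_pow {n : ℕ} (hn : n ≠ 0) :
    IntegrableOn (fun y => n * (y / (1 + y) * expWeight y ^ n)) (Ioi 0) := by
  refine integrableOn_Ioi_deriv_of_nonneg' (fun y hy => hasDerivAt_neg_expWeight_pow hn hy)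
    (fun y hy => ?_) (tendsto_neg_expWeight_pow_atTop hn)
  have hy : 0 < y := hy
  have := expWeight_pos hy.le
  positivity

theorem integral_div_one_add_mul_expWeight_pow {n : ℕ} (hn : n ≠ 0) :
    ∫ y in Ioi 0, n * (y / (1 + y) * expWeight y ^ n) = 1 := by
  rw [integral_Ioi_of_hasDerivAt_of_tendsto' (fun y hy => hasDerivAt_neg_expWeight_pow hn hy)
    (integrableOn_div_one_add_mul_expWeight_pow hn) (tendsto_neg_expWeight_pow_atTop hn)]
  simp [expWeight_zero]

theorem integral_pow_mul_exp_neg_mul_Ioi {r : ℝ} (hr : 0 < r) (j : ℕ) :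
    ∫ y in Ioi 0, y ^ j * Real.exp (-(r * y)) = (j ! : ℝ) / r ^ (j + 1) := by
  have h := Real.integral_rpow_mul_exp_neg_mul_Ioi (a := j + 1) (by positivity) hr
  rw [Real.Gamma_nat_eq_factorial, ← Nat.cast_add_one, Real.rpow_natCast] at h
  simpa [div_eq_inv_mul] using h

theorem integrableOn_pow_mul_exp_neg_mul_Ioi {r : ℝ} (hr : 0 < r) (j : ℕ) :
    IntegrableOn (fun y => y ^ j * Real.exp (-(r * y))) (Ioi 0) := by
  refine not_imp_comm.1 integral_undef ?_
  rw [integral_pow_mul_exp_neg_mul_Ioi hr]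
  positivity

theorem inv_one_add_mul_expWeight_pow_succ (m : ℕ) {y : ℝ} (hy : 0 ≤ y) :
    (1 + y)⁻¹ * expWeight y ^ (m + 1) = ∑ j ∈ Finset.range (m + 1),
      (m.choose j : ℝ) * (y ^ j * Real.exp (-((m + 1 : ℕ) * y))) := by
  have hbinom : (1 + y) ^ m = ∑ j ∈ Finset.range (m + 1), (m.choose j : ℝ) * y ^ j := by
    simp [add_comm 1 y, add_pow, mul_comm]
  rw [expWeight_pow, pow_succ', ← mul_assoc, inv_mul_cancel_left₀ (by positivity), hbinom,
    Finset.sum_mul]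
  simp only [mul_assoc]

theorem integrableOn_inv_one_add_mul_expWeight_pow {n : ℕ} (hn : n ≠ 0) :
    IntegrableOn (fun y => (1 + y)⁻¹ * expWeight y ^ n) (Ioi 0) := by
  obtain ⟨m, rfl⟩ := Nat.exists_eq_succ_of_ne_zero hn
  refine IntegrableOn.congr_fun (integrable_finsetSum _ fun j _ =>
    (integrableOn_pow_mul_exp_neg_mul_Ioi (by positivity) j).const_mul _)
    (fun y hy => (inv_one_add_mul_expWeight_pow_succ m (le_of_lt hy)).symm) measurableSet_Ioi

theorem mul_integral_inv_one_add_mul_expWeight_pow {n : ℕ} (hn : n ≠ 0) :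
    n * ∫ y in Ioi 0, (1 + y)⁻¹ * expWeight y ^ n =
      ∑ k ∈ Finset.range n, distinctProb n (k + 1) := by
  obtain ⟨m, rfl⟩ := Nat.exists_eq_succ_of_ne_zero hn
  have hr : (0 : ℝ) < (m + 1 : ℕ) := by positivity
  rw [setIntegral_congr_fun measurableSet_Ioi fun y hy =>
      inv_one_add_mul_expWeight_pow_succ m (le_of_lt hy),
    integral_finsetSum _ fun j _ => (integrableOn_pow_mul_exp_neg_mul_Ioi hr j).const_mul _,
    Finset.mul_sum]
  refine Finset.sum_congr rfl fun j _ => ?_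
  rw [integral_const_mul, integral_pow_mul_exp_neg_mul_Ioi hr, distinctProb,
    Nat.succ_descFactorial_succ, Nat.descFactorial_eq_factorial_mul_choose]
  push_cast
  field_simp

end ExpWeight

section GaussCoord

open Set Filter

/-- The coordinate `z ≥ 0` in which `expWeight` becomes the Gaussian `exp (-z ^ 2 / 2)`. -/
noncomputable def gaussCoord (y : ℝ) : ℝ := √(-2 * Real.log (expWeight y))

theorem gaussCoord_zero : gaussCoord 0 = 0 := by simp [gaussCoord, expWeight_zero]

theorem neg_two_mul_log_expWeight_pos {y : ℝ} (hy : 0 < y) : 0 < -2 * Real.log (expWeight y) :=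
  mul_pos_of_neg_of_neg (by norm_num) (Real.log_neg (expWeight_pos hy.le) (expWeight_lt_one hy))

theorem gaussCoord_pos {y : ℝ} (hy : 0 < y) : 0 < gaussCoord y :=
  Real.sqrt_pos.2 (neg_two_mul_log_expWeight_pos hy)

theorem gaussCoord_sq {y : ℝ} (hy : 0 < y) : gaussCoord y ^ 2 = -2 * Real.log (expWeight y) :=
  Real.sq_sqrt (neg_two_mul_log_expWeight_pos hy).le

theorem expWeight_pow_eq_exp (n : ℕ) {y : ℝ} (hy : 0 < y) :
    expWeight y ^ n = Real.exp (-(n / 2) * gaussCoord y ^ 2) := by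
  rw [← Real.exp_log (pow_pos (expWeight_pos hy.le) n), Real.log_pow, gaussCoord_sq hy]
  ring_nf

theorem hasDerivAt_neg_two_mul_log_expWeight {y : ℝ} (hy : 0 ≤ y) :
    HasDerivAt (fun y => -2 * Real.log (expWeight y)) (2 * (y / (1 + y))) y := by
  have hw := expWeight_pos hy
  refine (((hasDerivAt_expWeight hy).log hw.ne').const_mul (-2)).congr_deriv ?_
  field_simp

theorem hasDerivAt_gaussCoord {y : ℝ} (hy : 0 < y) :
    HasDerivAt gaussCoord (y / ((1 + y) * gaussCoord y)) y := by
  have hz := gaussCoord_pos hy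
  refine ((hasDerivAt_neg_two_mul_log_expWeight hy.le).sqrt
    (neg_two_mul_log_expWeight_pos hy).ne').congr_deriv ?_
  rw [← gaussCoord]
  field_simp

theorem continuousOn_gaussCoord : ContinuousOn gaussCoord (Ici 0) := fun _ hy =>
  (hasDerivAt_neg_two_mul_log_expWeight hy).continuousAt.sqrt.continuousWithinAt

theorem strictMonoOn_gaussCoord : StrictMonoOn gaussCoord (Ici 0) := by
  refine strictMonoOn_of_hasDerivWithinAt_pos (f' := fun y => y / ((1 + y) * gaussCoord y))
    (convex_Ici 0) continuousOn_gaussCoord ?_ ?_ <;> intro y hy <;> rw [interior_Ici] at hy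
  · exact (hasDerivAt_gaussCoord hy).hasDerivWithinAt
  · have hy : 0 < y := hy
    have hz := gaussCoord_pos hy
    positivity

theorem monotoneOn_gaussCoord : MonotoneOn gaussCoord (Ioi 0) :=
  strictMonoOn_gaussCoord.monotoneOn.mono Ioi_subset_Ici_self

theorem tendsto_gaussCoord_atTop : Tendsto gaussCoord atTop atTop := by
  have hw : Tendsto expWeight atTop (𝓝[>] 0) :=
    tendsto_nhdsWithin_iff.2 ⟨tendsto_expWeight_atTop,
      (eventually_ge_atTop 0).mono fun _ hy => expWeight_pos hy⟩
  exact Real.tendsto_sqrt_atTop.comp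
    ((Real.tendsto_log_nhdsGT_zero.comp hw).const_mul_atBot_of_neg (by norm_num))

theorem image_gaussCoord_Ioi : gaussCoord '' Ioi 0 = Ioi 0 := by
  rw [continuousOn_gaussCoord.image_Ioi_of_strictMonoOn strictMonoOn_gaussCoord
    tendsto_gaussCoord_atTop, gaussCoord_zero]

theorem mul_gaussCoord_lt {t : ℝ} (ht : 1 < t) : t * gaussCoord (t ^ 3 - 1) < t ^ 3 - 1 := by
  have hcube {s : ℝ} (hs : 1 < s) : 0 < s ^ 3 - 1 := sub_pos.2 (one_lt_pow₀ hs three_ne_zero)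
  have hsq : 0 < ((t ^ 3 - 1) / t) ^ 2 - -2 * Real.log (expWeight (t ^ 3 - 1)) := by
    refine pos_of_hasDerivAt_pos (a := 1)
      (f := fun s => ((s ^ 3 - 1) / s) ^ 2 - -2 * Real.log (expWeight (s ^ 3 - 1)))
      (f' := fun s => 2 * (s ^ 3 - 1) * ((s - 1) ^ 2 * (2 * s + 1)) / s ^ 3)
      (by simp [expWeight_zero]) (fun s hs => ?_) (fun s hs => ?_) ht
    · have hs0 : s ≠ 0 := by positivity
      have hd : HasDerivAt (fun s : ℝ => s ^ 3 - 1) (3 * s ^ 2) s := by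
        simpa using (hasDerivAt_pow 3 s).sub_const 1
      have hlog := (hasDerivAt_neg_two_mul_log_expWeight
        (sub_nonneg.2 (one_le_pow₀ hs : 1 ≤ s ^ 3))).comp s hd
      refine (((hd.fun_div (hasDerivAt_id s) hs0).fun_pow 2).fun_sub hlog).congr_deriv ?_
      simp only [id, add_sub_cancel, Nat.add_one_sub_one, pow_one, Nat.cast_ofNat]
      field_simp
      ring
    · have hs3 := hcube hs
      positivity
  have ht0 : 0 < t := by positivity
  rw [← gaussCoord_sq (hcube ht), sub_pos] at hsq
  rw [mul_comm, ← lt_div_iff₀ ht0]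
  exact lt_of_pow_lt_pow_left₀ 2 (div_pos (hcube ht) ht0).le hsq

theorem one_add_mul_gaussCoord_pow_three_lt {y : ℝ} (hy : 0 < y) :
    (1 + y) * gaussCoord y ^ 3 < y ^ 3 := by
  obtain ⟨t, ht, hty⟩ : ∃ t : ℝ, 1 < t ∧ t ^ 3 = 1 + y :=
    ⟨(1 + y) ^ ((3 : ℕ) : ℝ)⁻¹, Real.one_lt_rpow (by linarith) (by norm_num),
      Real.rpow_inv_natCast_pow (by positivity) three_ne_zero⟩
  obtain rfl : y = t ^ 3 - 1 := by linarith
  have hz := gaussCoord_pos hy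
  rw [← hty, ← mul_pow]
  exact pow_lt_pow_left₀ (mul_gaussCoord_lt ht) (by positivity) three_ne_zero

theorem div_lt_gaussCoord {y : ℝ} (hy : 0 < y) : 3 * y / (y + 3) < gaussCoord y := by
  have hsq : 0 < -2 * Real.log (expWeight y) - (3 * y / (y + 3)) ^ 2 := by
    refine pos_of_hasDerivAt_pos (a := 0)
      (f := fun x => -2 * Real.log (expWeight x) - (3 * x / (x + 3)) ^ 2)
      (f' := fun x => 2 * x ^ 3 * (x + 9) / ((1 + x) * (x + 3) ^ 3))
      (by simp [expWeight_zero]) (fun x hx => ?_) (fun x hx => by positivity) hy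
    have hnum : HasDerivAt (fun x : ℝ => 3 * x) 3 x := by
      simpa using (hasDerivAt_id x).const_mul 3
    have hdiv := hnum.fun_div ((hasDerivAt_id x).add_const 3) (by simp only [id]; positivity)
    refine ((hasDerivAt_neg_two_mul_log_expWeight hx).fun_sub (hdiv.fun_pow 2)).congr_deriv ?_
    simp only [id, Nat.add_one_sub_one, pow_one, Nat.cast_ofNat]
    field_simp
    ring
  rw [← gaussCoord_sq hy, sub_pos] at hsq
  exact lt_of_pow_lt_pow_left₀ 2 (gaussCoord_pos hy).le hsq

theorem deriv_gaussCoord_mul_expWeight_pow_eqOn (n : ℕ) :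
    EqOn (fun y => y / ((1 + y) * gaussCoord y) * expWeight y ^ n)
      (fun y => (y / ((1 + y) * gaussCoord y)) • Real.exp (-(n / 2) * gaussCoord y ^ 2))
      (Ioi 0) := fun y hy => by simp only [expWeight_pow_eq_exp n hy, smul_eq_mul]

theorem integrableOn_deriv_gaussCoord_mul_expWeight_pow {n : ℕ} (hn : n ≠ 0) :
    IntegrableOn (fun y => y / ((1 + y) * gaussCoord y) * expWeight y ^ n) (Ioi 0) := by
  have hgauss := (integrable_exp_neg_mul_sq (show 0 < (n / 2 : ℝ) by positivity)).integrableOn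
    (s := gaussCoord '' Ioi 0)
  rw [integrableOn_image_iff_integrableOn_deriv_smul_of_monotoneOn measurableSet_Ioi
    (fun y hy => (hasDerivAt_gaussCoord hy).hasDerivWithinAt) monotoneOn_gaussCoord] at hgauss
  exact hgauss.congr_fun (deriv_gaussCoord_mul_expWeight_pow_eqOn n).symm measurableSet_Ioi

theorem integral_deriv_gaussCoord_mul_expWeight_pow (n : ℕ) :
    ∫ y in Ioi 0, y / ((1 + y) * gaussCoord y) * expWeight y ^ n = √(Real.pi / (n / 2)) / 2 := by
  rw [setIntegral_congr_fun measurableSet_Ioi (deriv_gaussCoord_mul_expWeight_pow_eqOn n),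
    ← integral_image_eq_integral_deriv_smul_of_monotoneOn measurableSet_Ioi
      (fun y hy => (hasDerivAt_gaussCoord hy).hasDerivWithinAt)
      monotoneOn_gaussCoord fun z => Real.exp (-(n / 2) * z ^ 2),
    image_gaussCoord_Ioi, integral_gaussian_Ioi]

end GaussCoord

section ReciprocalGap

open Set Filter

/-- The function `1 / 3 + 1 / y - 1 / z`, where `z` is the Gaussian coordinate of `y`. It increases
from `0` to `1 / 3` on `(0, ∞)`; its value at `0` is the junk value `1 / 3` and not its limit. -/
noncomputable def reciprocalGap (y : ℝ) : ℝ := 1 / 3 + 1 / y - 1 / gaussCoord y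

/-- The derivative of `reciprocalGap` on `(0, ∞)`. -/
noncomputable def reciprocalGapDeriv (y : ℝ) : ℝ :=
  y / ((1 + y) * gaussCoord y ^ 3) - 1 / y ^ 2

theorem hasDerivAt_reciprocalGap {y : ℝ} (hy : 0 < y) :
    HasDerivAt reciprocalGap (reciprocalGapDeriv y) y := by
  have hz := gaussCoord_pos hy
  have h := ((hasDerivAt_inv hy.ne').const_add (1 / 3)).sub
    ((hasDerivAt_gaussCoord hy).fun_inv hz.ne')
  simp only [← one_div] at h
  refine h.congr_deriv ?_
  rw [reciprocalGapDeriv]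
  field_simp
  ring

theorem reciprocalGapDeriv_pos {y : ℝ} (hy : 0 < y) : 0 < reciprocalGapDeriv y := by
  have hz := gaussCoord_pos hy
  have hlt := one_add_mul_gaussCoord_pow_three_lt hy
  rw [reciprocalGapDeriv, sub_pos, div_lt_div_iff₀ (by positivity) (by positivity)]
  linarith

theorem reciprocalGap_pos {y : ℝ} (hy : 0 < y) : 0 < reciprocalGap y := by
  have hinv := one_div_lt_one_div_of_lt (by positivity) (div_lt_gaussCoord hy)
  have heq : 1 / (3 * y / (y + 3)) = 1 / 3 + 1 / y := by field_simp
  rw [heq] at hinv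
  exact sub_pos.2 hinv

theorem reciprocalGap_le {y : ℝ} (hy : 0 < y) : reciprocalGap y ≤ y / 9 := by
  have hz := gaussCoord_pos hy
  have hroot : (1 + y / 3 - y ^ 2 / 9) ^ 3 ≤ 1 + y := by
    have hpos : 0 ≤ (y / 3) ^ 3 * ((y / 3 - 2) ^ 2 * (y / 3 + 1) + 1) := by positivity
    linear_combination hpos
  have hmul : (1 + y / 3 - y ^ 2 / 9) * gaussCoord y < y := by
    refine lt_of_pow_lt_pow_left₀ 3 hy.le ?_
    rw [mul_pow]
    exact (mul_le_mul_of_nonneg_right hroot (by positivity)).trans_lt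
      (one_add_mul_gaussCoord_pow_three_lt hy)
  have hinv : (1 + y / 3 - y ^ 2 / 9) / y ≤ 1 / gaussCoord y := by
    rw [div_le_div_iff₀ hy hz, one_mul]
    exact hmul.le
  have heq : (1 + y / 3 - y ^ 2 / 9) / y = 1 / 3 + 1 / y - y / 9 := by
    field_simp
    ring
  rw [reciprocalGap]
  linarith

theorem tendsto_reciprocalGap_nhdsGT : Tendsto reciprocalGap (𝓝[>] 0) (𝓝 0) := by
  have hlim : Tendsto (fun y : ℝ => y / 9) (𝓝[>] 0) (𝓝 0) :=
    ((continuous_id.div_const 9).tendsto' 0 0 (zero_div 9)).mono_left nhdsWithin_le_nhds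
  exact tendsto_of_tendsto_of_tendsto_of_le_of_le' tendsto_const_nhds hlim
    (eventually_mem_nhdsWithin.mono fun y hy => (reciprocalGap_pos hy).le)
    (eventually_mem_nhdsWithin.mono fun y hy => reciprocalGap_le hy)

theorem tendsto_reciprocalGap_atTop : Tendsto reciprocalGap atTop (𝓝 (1 / 3)) := by
  have h := (tendsto_inv_atTop_zero.const_add (1 / 3 : ℝ)).sub
    tendsto_gaussCoord_atTop.inv_tendsto_atTop
  rw [add_zero, sub_zero] at h
  exact h.congr fun y => by rw [reciprocalGap, one_div y, one_div (gaussCoord y), Pi.inv_apply]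

theorem integrableOn_reciprocalGapDeriv : IntegrableOn reciprocalGapDeriv (Ioi 0) :=
  integrableOn_Ioi_deriv_of_nonneg_of_tendsto (fun _ hy => hasDerivAt_reciprocalGap hy)
    (fun _ hy => (reciprocalGapDeriv_pos hy).le) tendsto_reciprocalGap_nhdsGT
    tendsto_reciprocalGap_atTop

theorem reciprocalGap_mul_eqOn (n : ℕ) :
    EqOn (fun y => reciprocalGap y * (n * (y / (1 + y) * expWeight y ^ n)))
      (fun y => 1 / 3 * (n * (y / (1 + y) * expWeight y ^ n)) +
        n * ((1 + y)⁻¹ * expWeight y ^ n) -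
        n * (y / ((1 + y) * gaussCoord y) * expWeight y ^ n)) (Ioi 0) := by
  intro y hy
  have hy : 0 < y := hy
  have hz := gaussCoord_pos hy
  simp only [reciprocalGap]
  field_simp

theorem mul_sqrt_div_half (c : ℝ) {x : ℝ} (hx : 0 < x) :
    x * (√(c / (x / 2)) / 2) = √(c * x / 2) := by
  rw [show c * x / 2 = (x / 2) ^ 2 * (c / (x / 2)) by field_simp,
    Real.sqrt_mul (by positivity), Real.sqrt_sq (by positivity)]
  ring

section

variable {n : ℕ} (hn : n ≠ 0)
include hn

theorem integrableOn_reciprocalGap_mul :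
    IntegrableOn (fun y => reciprocalGap y * (n * (y / (1 + y) * expWeight y ^ n))) (Ioi 0) :=
  IntegrableOn.congr_fun
    ((((integrableOn_div_one_add_mul_expWeight_pow hn).const_mul _).add
      ((integrableOn_inv_one_add_mul_expWeight_pow hn).const_mul _)).sub
      ((integrableOn_deriv_gaussCoord_mul_expWeight_pow hn).const_mul _))
    (reciprocalGap_mul_eqOn n).symm measurableSet_Ioi

theorem integral_reciprocalGap_mul :
    ∫ y in Ioi 0, reciprocalGap y * (n * (y / (1 + y) * expWeight y ^ n)) = kappa n := by
  have hA := (integrableOn_div_one_add_mul_expWeight_pow hn).const_mul (1 / 3)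
  have hB := (integrableOn_inv_one_add_mul_expWeight_pow hn).const_mul (n : ℝ)
  have hC := (integrableOn_deriv_gaussCoord_mul_expWeight_pow hn).const_mul (n : ℝ)
  rw [setIntegral_congr_fun measurableSet_Ioi (reciprocalGap_mul_eqOn n),
    integral_sub (hA.fun_add hB) hC, integral_add hA hB, integral_const_mul,
    integral_div_one_add_mul_expWeight_pow hn, integral_const_mul,
    mul_integral_inv_one_add_mul_expWeight_pow hn, integral_const_mul,
    integral_deriv_gaussCoord_mul_expWeight_pow, mul_sqrt_div_half _ (by positivity),
    kappa_eq_sum_distinctProb hn]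
  ring

theorem kappa_eq_integral :
    kappa n = ∫ y in Ioi 0, reciprocalGapDeriv y * expWeight y ^ n := by
  have hzero : Tendsto (reciprocalGap * fun y => -expWeight y ^ n) (𝓝[>] 0) (𝓝 0) := by
    have h := tendsto_reciprocalGap_nhdsGT.mul
      ((continuous_expWeight.pow n).neg.continuousWithinAt (s := Ioi 0) (x := 0))
    rwa [zero_mul] at h
  have htop : Tendsto (reciprocalGap * fun y => -expWeight y ^ n) atTop (𝓝 0) := by
    have h := tendsto_reciprocalGap_atTop.mul (tendsto_neg_expWeight_pow_atTop hn)
    rwa [mul_zero] at h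
  have hint : IntegrableOn (reciprocalGapDeriv * fun y => -expWeight y ^ n) (Ioi 0) := by
    refine (integrableOn_mul_expWeight_pow integrableOn_reciprocalGapDeriv n).neg.congr_fun
      (fun y _ => (mul_neg _ _).symm) measurableSet_Ioi
  have hparts := integral_Ioi_mul_deriv_eq_deriv_mul (fun y hy => hasDerivAt_reciprocalGap hy)
    (fun y hy => hasDerivAt_neg_expWeight_pow hn (le_of_lt hy))
    (integrableOn_reciprocalGap_mul hn) hint hzero htop
  simpa [integral_reciprocalGap_mul hn, integral_neg] using hparts

end

theorem strictAntiOn_kappa : StrictAntiOn kappa (Ici 1) :=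
  ((strictAnti_integral_mul_expWeight_pow integrableOn_reciprocalGapDeriv
    fun _ => reciprocalGapDeriv_pos).strictAntiOn _).congr
    fun _ hn => (kappa_eq_integral (Nat.one_le_iff_ne_zero.1 hn)).symm

theorem tendsto_kappa : Tendsto kappa atTop (𝓝 0) :=
  (tendsto_integral_mul_expWeight_pow integrableOn_reciprocalGapDeriv).congr'
    ((eventually_ne_atTop 0).mono fun _ hn => (kappa_eq_integral hn).symm)

end ReciprocalGap

theorem theorem10 :
    (∀ (n : ℕ), 1 ≤ n → ∀ (v₀ : Fin n → ℕ)
        (Ω : Type*) [MeasurableSpace Ω] (P : Measure Ω) [IsProbabilityMeasure P]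
        (x : Fin n → Ω → Fin n),
        (∀ i, Measurable (x i)) → iIndepFun x P →
        (∀ i k, P {ω | x i ω = k} = 1 / (n : ℝ≥0∞)) →
        ∫ ω, ((linear n v₀ (fun i => x i ω)).time : ℝ) ∂P
          = n + √(2 * Real.pi * n) + 7 / 3 + 2 * kappa n - 2 * ((n ! : ℝ) / (n : ℝ) ^ n)) ∧
      StrictAntiOn kappa (Set.Ici 1) ∧
      Filter.Tendsto kappa Filter.atTop (𝓝 0) := by
  refine ⟨fun n hn v₀ Ω _ P _ x hx hindep hunif => ?_, strictAntiOn_kappa, tendsto_kappa⟩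
  have hsum : ∑ k ∈ Finset.range n, distinctProb n k =
      ∑ k ∈ Finset.range n, distinctProb n (k + 1) + 1 - distinctProb n n := by
    rw [← distinctProb_zero n, ← Finset.sum_range_succ', Finset.sum_range_succ,
      add_sub_cancel_right]
  have hsqrt : √(2 * Real.pi * n) = 2 * √(Real.pi * n / 2) := by
    rw [show 2 * Real.pi * n = 2 ^ 2 * (Real.pi * n / 2) by ring, Real.sqrt_mul (by norm_num),
      Real.sqrt_sq (by norm_num)]
  rw [integral_time_linear v₀ hx hindep hunif, hsum, hsqrt, distinctProb_self,
    kappa_eq_sum_distinctProb (Nat.one_le_iff_ne_zero.1 hn)]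
  ring
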